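/- Let $F$ be a number field with ring of integers $\mathcal{O}_F$, let $d \ge 3$ be an integer, and let $A, B \in \mathcal{O}_F$ be such that $f(x) = x^d + A x^{d-1} + B$ is irreducible over $F$. Let $L$ be a splitting field of $f$ over $F$, and let $X$ be the set of roots of $f$ in $L$. Suppose that there is a nonzero prime ideal $\mathfrak{p}$ of $\mathcal{O}_F$ that divides the ideal $(B)$ but not the ideal $(A)$, and such that $\gcd(d-1, v_{\mathfrak{p}}(B)) = 1$, where $v_{\mathfrak{p}}(B)$ is the exponent of $\mathfrak{p}$ in the factorization of $(B)$. Then $X$ has exactly $d$ elements, and $\mathrm{Gal}(L/F)$ contains a subgroup $H$ that fixes some root $\alpha \in X$ and acts transitively on the remaining $d-1$ roots $X \setminus \{\alpha\}$. Moreover, $\mathrm{Gal}(L/F)$ acts faithfully and doubly transitively on $X$; that is, it is a doubly transitive subgroup of $\mathrm{Sym}(X) \cong S_d$. -/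

import Mathlib

open Polynomial NumberField

section Ramification

/-! Put n = d - 1 and let P be a prime of L above 𝔭. Since f ≡ x^n (x + A) mod 𝔭 and A ∉ 𝔭, some
root b lies in P and some root a ≡ -A does not. The subgroup H is the inertia group of P, which
preserves P, so the H-orbit of b avoids a. Let q be the prime of F(b) below P. Valuations in b^n (b
+ A) = -B give n v_q(b) = e(q/𝔭) v_𝔭(B), so n ∣ e(q/𝔭) by coprimality
(`dvd_ramificationIdx_of_root_mem`). That index is the size of the orbit of b
(`card_orbit_inertia`), so the orbit consists of all n roots other than a. Irreducibility of f makes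
the full group transitive, which upgrades this to double transitivity. -/

/-- Let `q` lie over `p` and contain a root of `X ^ n * (X + A) + B`, where `A ∉ p`. If `n` is prime
to `v_p(B)`, then `n` divides the ramification index of `q` over `p`. -/
theorem dvd_ramificationIdx_of_root_mem {R S : Type*} [CommRing R] [IsDedekindDomain R]
    [CommRing S] [IsDedekindDomain S] [Algebra R S] [FaithfulSMul R S] {n : ℕ} (hn0 : n ≠ 0)
    {A B : R} (hB : B ≠ 0) {p : Ideal R} [p.IsPrime] (hp : p ≠ ⊥) (hA : A ∉ p)
    (hn : Nat.gcd n (multiplicity p (Ideal.span {B})) = 1) {q : Ideal S} [q.IsPrime]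
    [q.LiesOver p] {b : S} (hb : b ∈ q)
    (h : b ^ n * (b + algebraMap R S A) = -algebraMap R S B) :
    n ∣ q.ramificationIdx R := by
  have hmap : p.map (algebraMap R S) ≠ ⊥ := Ideal.map_ne_bot_of_ne_bot hp
  have hq : q ≠ ⊥ := ne_bot_of_le_ne_bot hmap (Ideal.map_le_of_le_comap (q.over_def p).le)
  have hqp : Prime q := Ideal.prime_of_isPrime hq inferInstance
  have hpp : Prime p := Ideal.prime_of_isPrime hp inferInstance
  have hBI : Ideal.span {B} ≠ ⊥ := by simpa using hB
  have hbA : b + algebraMap R S A ∉ q := fun hmem ↦ hA <| by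
    rw [q.over_def p, Ideal.mem_comap]
    simpa using q.sub_mem hmem hb
  have hb0 : b ≠ 0 := by
    rintro rfl
    rw [zero_pow hn0, zero_mul, eq_comm, neg_eq_zero] at h
    exact hB ((map_eq_zero_iff _ (FaithfulSMul.algebraMap_injective R S)).mp h)
  have hspan : (Ideal.span {B}).map (algebraMap R S) =
      Ideal.span {b} ^ n * Ideal.span {b + algebraMap R S A} := by
    rw [Ideal.map_span, Set.image_singleton, ← Ideal.span_singleton_neg, ← h,
      Ideal.span_singleton_pow, Ideal.span_singleton_mul_span_singleton]
  have hfin : FiniteMultiplicity p (Ideal.span {B}) := .of_prime_left hpp hBI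
  have hfinb : FiniteMultiplicity q (Ideal.span {b}) :=
    .of_prime_left hqp (by simpa using hb0)
  have key := Ideal.IsDedekindDomain.emultiplicity_map_eq_ramificationIdx'_mul (w := q) hBI
    hpp.irreducible hqp.irreducible hq
  -- As `b + A ∉ q`, only the factor `(b) ^ n` contributes to the valuation at `q`.
  rw [hspan, emultiplicity_mul hqp, emultiplicity_pow hqp,
    (emultiplicity_eq_zero (b := Ideal.span {b + algebraMap R S A})).mpr
      (by rwa [Ideal.dvd_span_singleton]), add_zero, hfin.emultiplicity_eq_multiplicity,
    hfinb.emultiplicity_eq_multiplicity,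
    Ideal.ramificationIdx'_eq_ramificationIdx p q hp] at key
  exact Nat.Coprime.dvd_of_dvd_mul_right hn (Dvd.intro _ (by exact_mod_cast key))

variable {F L : Type*} [Field F] [Field L] [NumberField F] [NumberField L] [Algebra F L]

open IntermediateField in
/-- The orbit of `β` under the inertia group of `P` has as many elements as the ramification index
of the prime of `F(β)` below `P`. -/
theorem card_orbit_inertia [IsGalois F L] (P : Ideal (𝓞 L)) [P.IsPrime] (β : L) :
    Nat.card (MulAction.orbit (P.inertia Gal(L/F)) β) =
      (P.under (𝓞 F⟮β⟯)).ramificationIdx (𝓞 F) := by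
  set K := F⟮β⟯
  let S := fixingSubgroup Gal(L/F) (K : Set L)
  have : IsGaloisGroup S (𝓞 K) (𝓞 L) := IsGaloisGroup.of_isFractionRing _ (𝓞 K) (𝓞 L) K L
  have hF : Nat.card (P.inertia Gal(L/F)) = P.ramificationIdx (𝓞 F) := by
    rw [Ideal.card_inertia_eq_ramificationIdxIn (P.under (𝓞 F)) P,
      Ideal.ramificationIdxIn_eq_ramificationIdx _ P Gal(L/F)]
  have hK : Nat.card (P.inertia S) = P.ramificationIdx (𝓞 K) := by
    rw [Ideal.card_inertia_eq_ramificationIdxIn (P.under (𝓞 K)) P,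
      Ideal.ramificationIdxIn_eq_ramificationIdx _ P S]
  have hmem (σ : Gal(L/F)) : σ ∈ S ↔ σ β = β := by
    refine ⟨fun h ↦ h ⟨β, mem_adjoin_simple_self F β⟩, fun h x ↦ ?_⟩
    exact (forall_mem_adjoin_smul_eq_self_iff F (S := {β}) σ).mpr (by simpa using h) x.1 x.2
  -- The stabilizer of `β` in the inertia group over `F` is the inertia group over `K`, so
  -- orbit-stabilizer and multiplicativity of ramification indices leave the index of `K` over `F`.
  have hstab : Nat.card (MulAction.stabilizer (P.inertia Gal(L/F)) β) = Nat.card (P.inertia S) :=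
    Nat.card_congr
      { toFun := fun σ ↦ ⟨⟨σ.1.1, (hmem _).mpr σ.2⟩, σ.1.2⟩
        invFun := fun σ ↦ ⟨⟨σ.1.1, σ.2⟩, (hmem _).mp σ.1.2⟩ }
  have horb := Nat.card_congr (MulAction.orbitProdStabilizerEquivGroup (P.inertia Gal(L/F)) β)
  rw [Nat.card_prod, hstab, hF, hK, Ideal.ramificationIdx_tower (R := 𝓞 F) (P.under (𝓞 K)) P] at horb
  exact Nat.eq_of_mul_eq_mul_right (P.ramificationIdx_pos (𝓞 K)) horb

omit [NumberField F] [NumberField L] in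
/-- A root of `X ^ n * (X + A) + B` is integral. -/
theorem exists_ringOfIntegers_root {n : ℕ} {A B : 𝓞 F} {x : L}
    (hx : x ^ n * (x + algebraMap F L A) = -algebraMap F L B) :
    ∃ b : 𝓞 L, (b : L) = x ∧
      b ^ n * (b + algebraMap (𝓞 F) (𝓞 L) A) = -algebraMap (𝓞 F) (𝓞 L) B := by
  have hint : IsIntegral (𝓞 F) x := by
    refine ⟨X ^ n * (X + C A) + C B, ?_, ?_⟩
    · have hmon : (X ^ n * (X + C A)).Monic := (monic_X_pow n).mul (monic_X_add_C A)
      refine hmon.add_of_left ?_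
      refine degree_C_le.trans_lt ?_
      rw [degree_mul, degree_X_pow, degree_X_add_C]
      exact_mod_cast n.succ_pos
    · have hA : algebraMap (𝓞 F) L A = algebraMap F L A := IsScalarTower.algebraMap_apply _ F L A
      have hB : algebraMap (𝓞 F) L B = algebraMap F L B := IsScalarTower.algebraMap_apply _ F L B
      simp [hA, hB, hx]
  refine ⟨⟨x, isIntegral_trans (R := ℤ) (A := 𝓞 F) x hint⟩, rfl, RingOfIntegers.ext hx⟩

omit [NumberField F] [NumberField L] in
/-- If a monic polynomial with integral roots takes at `c` a value in the prime `P`, then some root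
of it is congruent to `c` modulo `P`. -/
theorem exists_root_sub_mem {f : F[X]} (hf : f.Monic) (hs : (f.map (algebraMap F L)).Splits)
    (hint : ∀ x ∈ f.rootSet L, ∃ b : 𝓞 L, (b : L) = x)
    {P : Ideal (𝓞 L)} [P.IsPrime] {c v : 𝓞 L} (hv : v ∈ P) (hc : aeval (c : L) f = v) :
    ∃ b : 𝓞 L, (b : L) ∈ f.rootSet L ∧ c - b ∈ P := by
  have hlift : ∀ x ∈ f.aroots L, ∃ b : 𝓞 L, (b : L) = x := fun x hx ↦
    hint x (by rwa [mem_rootSet', ← mem_aroots'])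
  obtain ⟨s, hs'⟩ : ∃ s : Multiset (𝓞 L), s.map (algebraMap (𝓞 L) L) = f.aroots L := by
    choose! g hg using hlift
    exact ⟨(f.aroots L).map g, by
      rw [Multiset.map_map, Multiset.map_congr rfl (g := id) (by simpa using hg), Multiset.map_id]⟩
  -- This is f(c) = ∏ (c - b) over the roots b; as `P` is prime, one factor lies in it.
  have hprod : (s.map fun b ↦ c - b).prod = v := by
    refine RingOfIntegers.ext ?_
    rw [← hc, aeval_def, ← eval_map, hs.eval_eq_prod_roots_of_monic (hf.map _), ← aroots_def, ← hs',
      Multiset.map_map]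
    exact (map_multiset_prod (algebraMap (𝓞 L) L) _).trans (by simp)
  rw [← hprod, Ideal.IsPrime.multiset_prod_mem_iff_exists_mem ‹_›] at hv
  obtain ⟨_, hb, hbP⟩ := hv
  obtain ⟨b, hbs, rfl⟩ := Multiset.mem_map.mp hb
  refine ⟨b, ?_, hbP⟩
  rw [mem_rootSet', ← mem_aroots', ← hs']
  exact Multiset.mem_map_of_mem _ hbs

end Ramification

/-- The Galois group of a splitting field acts faithfully on the roots. -/
theorem toPermHom_rootSet_injective {F L : Type*} [Field F] [Field L] [Algebra F L] (f : F[X])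
    [f.IsSplittingField F L] :
    Function.Injective (MulAction.toPermHom Gal(L/F) (f.rootSet L)) := by
  refine (injective_iff_map_eq_one _).mpr fun σ hσ ↦ ?_
  have hfix : ∀ x ∈ f.rootSet L, σ • x = x := fun x hx ↦
    congrArg Subtype.val (Equiv.congr_fun hσ ⟨x, hx⟩)
  ext x
  exact (Algebra.forall_mem_adjoin_smul_eq_self_iff (R := F) (f.rootSet L) σ).mpr hfix x
    (IsSplittingField.adjoin_rootSet L f ▸ Algebra.mem_top)

/-- The Galois group of a normal extension acts transitively on the roots of an irreducible
polynomial. -/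
theorem isPretransitive_rootSet {F L : Type*} [Field F] [Field L] [Algebra F L] [Normal F L]
    {f : F[X]} (hf : Irreducible f) : MulAction.IsPretransitive Gal(L/F) (f.rootSet L) where
  exists_smul_eq x y := by
    have hx := minpoly.eq_of_irreducible hf (mem_rootSet.mp x.2).2
    have hy := minpoly.eq_of_irreducible hf (mem_rootSet.mp y.2).2
    obtain ⟨g, hg⟩ := (Normal.minpoly_eq_iff_mem_orbit L).mp (hy.symm.trans hx)
    exact ⟨g, Subtype.ext hg⟩

/-- A transitive action is doubly transitive as soon as the stabilizer of some point is transitive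
on the remaining points. -/
theorem isMultiplyPretransitive_two_of_stabilizer {G X : Type*} [Group G] [MulAction G X]
    [MulAction.IsPretransitive G X] (x : X)
    (h : ∀ y z : X, y ≠ x → z ≠ x → ∃ g : G, g • x = x ∧ g • y = z) :
    MulAction.IsMultiplyPretransitive G X 2 := by
  refine MulAction.is_two_pretransitive_iff.mpr fun {a b c d} hab hcd ↦ ?_
  obtain ⟨g, rfl⟩ := MulAction.exists_smul_eq G x a
  obtain ⟨k, rfl⟩ := MulAction.exists_smul_eq G x c
  obtain ⟨τ, hτx, hτ⟩ := h (g⁻¹ • b) (k⁻¹ • d)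
    (fun h ↦ hab (by rw [← h, smul_inv_smul])) (fun h ↦ hcd (by rw [← h, smul_inv_smul]))
  exact ⟨k * τ * g⁻¹, by simp [mul_smul, hτx], by simp [mul_smul, hτ]⟩

/-- `L` is a splitting field of `f = X ^ d + A X ^ (d - 1) + B` over the number field `F`, the group
`Gal(L/F)` acts on the set `f.rootSet L` of roots of `f` in `L` by evaluation, and `v_𝔭(B)` is the
exponent of `𝔭` in the factorization of the ideal `(B)` (`B ≠ 0` as `f` is irreducible). -/
theorem mainTheorem8 {F : Type*} [Field F] [NumberField F]
    (d : ℕ) (hd : 3 ≤ d) (A B : 𝓞 F) (f : F[X])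
    (hf : f = X ^ d + C (A : F) * X ^ (d - 1) + C (B : F))
    (hirr : Irreducible f)
    (L : Type*) [Field L] [Algebra F L] [f.IsSplittingField F L]
    (hp : ∃ 𝔭 : IsDedekindDomain.HeightOneSpectrum (𝓞 F),
      𝔭.asIdeal ∣ Ideal.span {B} ∧ ¬ 𝔭.asIdeal ∣ Ideal.span {A} ∧
        Nat.gcd (d - 1) (multiplicity 𝔭.asIdeal (Ideal.span {B})) = 1) :
    (f.rootSet L).ncard = d ∧
    (∃ (H : Subgroup Gal(L/F)) (x : f.rootSet L),
      (∀ σ ∈ H, σ • x = x) ∧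
      ∀ y z : f.rootSet L, y ≠ x → z ≠ x → ∃ σ ∈ H, σ • y = z) ∧
    Function.Injective (MulAction.toPermHom Gal(L/F) (f.rootSet L)) ∧
    MulAction.IsMultiplyPretransitive Gal(L/F) (f.rootSet L) 2 := by
  have : FiniteDimensional F L := IsSplittingField.finiteDimensional L f
  have : NumberField L := NumberField.of_module_finite F L
  have : IsGalois F L := IsGalois.of_separable_splitting_field hirr.separable
  have hsplit := IsSplittingField.splits L f
  obtain ⟨n, rfl⟩ : ∃ n, d = n + 1 := ⟨d - 1, by lia⟩
  have hn0 : n ≠ 0 := by lia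
  rw [Nat.add_sub_cancel] at hf hp
  have hdeg : f.natDegree = n + 1 := by
    rw [hf]
    compute_degree!
  have hmon : f.Monic := by
    rw [hf]
    monicity!
  have hcard : (f.rootSet L).ncard = n + 1 := by
    rw [Set.ncard_eq_toFinset_card', Set.toFinset_card,
      card_rootSet_eq_natDegree hirr.separable hsplit, hdeg]
  have haeval {E : Type _} [Field E] [Algebra F E] (x : E) :
      aeval x f = x ^ n * (x + algebraMap F E A) + algebraMap F E B := by
    rw [hf]
    simp
    ring
  have hB : B ≠ 0 := by
    rintro rfl
    have hroot : f.IsRoot 0 := by simp [hf, hn0]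
    have : f.natDegree = 1 := natDegree_eq_of_degree_eq_some (degree_eq_one_of_irreducible_of_root hirr hroot)
    lia
  obtain ⟨⟨p, hpp, hp0⟩, hBp, hAp, hgcd⟩ := hp
  dsimp only at hBp hAp hgcd
  rw [Ideal.dvd_span_singleton] at hBp hAp
  obtain ⟨P, hPp, hPo⟩ := (inferInstance : Nonempty (p.primesOver (𝓞 L)))
  have hmemP (a : 𝓞 F) : algebraMap (𝓞 F) (𝓞 L) a ∈ P ↔ a ∈ p := by
    rw [hPo.over, Ideal.mem_comap]
  have hroots : ∀ x ∈ f.rootSet L, x ^ n * (x + algebraMap F L A) = -algebraMap F L B :=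
    fun x hx ↦ eq_neg_of_add_eq_zero_left (by rw [← haeval, (mem_rootSet.mp hx).2])
  have hint : ∀ x ∈ f.rootSet L, ∃ b : 𝓞 L, (b : L) = x := fun x hx ↦
    (exists_ringOfIntegers_root (hroots x hx)).imp fun _ h ↦ h.1
  have hBP : algebraMap (𝓞 F) (𝓞 L) B ∈ P := (hmemP B).mpr hBp
  -- a root in `P` and a root outside `P`
  obtain ⟨b, hb, hbP⟩ := exists_root_sub_mem hmon hsplit hint (c := 0) hBP
    (by rw [haeval]; simp [hn0]; rfl)
  -- Evaluating at -A kills the factor x + A, so f(-A) = B ∈ P.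
  obtain ⟨a, ha, haP⟩ := exists_root_sub_mem hmon hsplit hint (c := -algebraMap (𝓞 F) (𝓞 L) A) hBP
    (by
      have hA : ((-algebraMap (𝓞 F) (𝓞 L) A : 𝓞 L) : L) = -algebraMap F L A := rfl
      rw [haeval, hA, neg_add_cancel, mul_zero, zero_add]
      rfl)
  replace hbP : b ∈ P := by simpa using hbP
  replace haP : a ∉ P := fun h ↦ hAp ((hmemP A).mp (by simpa using P.add_mem haP h))
  -- the inertia group preserves `P`
  have hinertia : ∀ σ ∈ P.inertia Gal(L/F), ∀ c : 𝓞 L, σ • c ∈ P ↔ c ∈ P := fun σ hσ c ↦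
    ⟨fun h ↦ by simpa using P.sub_mem h (hσ c), fun h ↦ by simpa using P.add_mem (hσ c) h⟩
  have horbit_sub : MulAction.orbit (P.inertia Gal(L/F)) (b : L) ⊆ f.rootSet L \ {(a : L)} := by
    rintro _ ⟨σ, rfl⟩
    refine ⟨smul_mem_rootSet σ.1 hb, fun h ↦ haP ?_⟩
    rw [← show σ.1 • b = a from RingOfIntegers.ext h]
    exact (hinertia σ.1 σ.2 b).mpr hbP
  have hdiff : (f.rootSet L \ {(a : L)}).ncard = n := by
    rw [Set.ncard_sdiff_singleton_of_mem ha, hcard, Nat.add_sub_cancel]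
  have hdvd : n ∣ (MulAction.orbit (P.inertia Gal(L/F)) (b : L)).ncard := by
    rw [← Nat.card_coe_set_eq, card_orbit_inertia]
    let γ := IntermediateField.AdjoinSimple.gen F (b : L)
    obtain ⟨c, hcγ, hc⟩ := exists_ringOfIntegers_root (n := n) (A := A) (B := B) (x := γ)
      (Subtype.ext (hroots b hb))
    have hcb : algebraMap (𝓞 (IntermediateField.adjoin F {(b : L)})) (𝓞 L) c = b :=
      RingOfIntegers.ext (show ((c : IntermediateField.adjoin F {(b : L)}) : L) = b by rw [hcγ]; rfl)
    have : (P.under (𝓞 (IntermediateField.adjoin F {(b : L)}))).LiesOver p :=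
      Ideal.LiesOver.tower_bot P _ p
    exact dvd_ramificationIdx_of_root_mem hn0 hB hp0 hAp hgcd
      (Ideal.mem_comap.mpr (by rwa [hcb])) hc
  -- A nonempty orbit of size divisible by `n` inside a set of `n` elements is the whole set.
  have horbit : MulAction.orbit (P.inertia Gal(L/F)) (b : L) = f.rootSet L \ {(a : L)} := by
    refine Set.eq_of_subset_of_ncard_le horbit_sub ?_ (Set.toFinite _)
    rw [hdiff]
    exact Nat.le_of_dvd ((Set.ncard_pos ((Set.toFinite _).subset horbit_sub)).mpr
      (MulAction.nonempty_orbit _)) hdvd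
  have hfix : ∀ σ ∈ P.inertia Gal(L/F), σ • (⟨a, ha⟩ : f.rootSet L) = ⟨a, ha⟩ := by
    intro σ hσ
    -- If `σ` moved `a`, then `σ • a` would be in the orbit of `b`, hence in `P`, forcing `a ∈ P`.
    by_contra hne
    have hmem : ((σ • a : 𝓞 L) : L) ∈ f.rootSet L \ {(a : L)} :=
      ⟨smul_mem_rootSet σ ha, fun h ↦ hne (Subtype.ext h)⟩
    rw [← horbit] at hmem
    obtain ⟨τ, hτ⟩ := hmem
    have hτ' : τ.1 • b = σ • a := RingOfIntegers.ext hτ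
    exact haP ((hinertia σ hσ a).mp (hτ' ▸ (hinertia τ.1 τ.2 b).mpr hbP))
  have htrans : ∀ y z : f.rootSet L, y ≠ ⟨a, ha⟩ → z ≠ ⟨a, ha⟩ →
      ∃ σ ∈ P.inertia Gal(L/F), σ • y = z := by
    intro y z hy hz
    have hy' : (y : L) ∈ MulAction.orbit (P.inertia Gal(L/F)) (b : L) :=
      horbit ▸ ⟨y.2, fun h ↦ hy (Subtype.ext h)⟩
    have hz' : (z : L) ∈ MulAction.orbit (P.inertia Gal(L/F)) (b : L) :=
      horbit ▸ ⟨z.2, fun h ↦ hz (Subtype.ext h)⟩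
    rw [← MulAction.orbit_eq_iff.mpr hy'] at hz'
    obtain ⟨σ, hσ⟩ := hz'
    exact ⟨σ.1, σ.2, Subtype.ext hσ⟩
  have := isPretransitive_rootSet (L := L) hirr
  exact ⟨hcard, ⟨P.inertia Gal(L/F), ⟨a, ha⟩, hfix, htrans⟩, toPermHom_rootSet_injective f,
    isMultiplyPretransitive_two_of_stabilizer ⟨a, ha⟩ fun y z hy hz ↦
      (htrans y z hy hz).imp fun σ hσ ↦ ⟨hfix σ hσ.1, hσ.2⟩⟩
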